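/- Let $K$ be an algebraically closed field of characteristic zero (for instance $K=\mathbb C$), let $\mathfrak g$ be a finite-dimensional Lie algebra over $K$, and let $\rho:\mathfrak g\to \mathrm{gl}(V)$ be a representation on a finite-dimensional $K$-vector space $V$. For $x\in V$ let $R_x:\mathfrak g\to V$, $R_x(\xi)=\rho(\xi)x$, and $\mathrm{St}_x=\mathrm{Ker}\,R_x$. Put $r=\dim\mathcal O_{\mathrm{reg}}=\max_{x\in V}\mathrm{rk}\,R_x$ and $q=\mathrm{codim}\,\mathcal O_{\mathrm{reg}}=\dim V-r$. A point $x$ is regular if $\dim\mathrm{St}_x$ is minimal (equivalently $\mathrm{rk}\,R_x=r$), and $\mathsf{Sing}\subset V$ denotes the (Zariski closed) set of non-regular points; its codimension is the smallest codimension of an irreducible component, and is $\infty$ if $\mathsf{Sing}=\emptyset$. Let $\mathsf p_\rho\in K[V]$ be the fundamental semi-invariant of $\rho$, i.e. the greatest common divisor of all $r\times r$ minors of the matrix of $R_x$ (with respect to bases of $\mathfrak g$ and $V$), viewed as polynomials in $x$. A polynomial $f\in K[V]$ is an invariant of $\rho$ if $R_x^*(df(x))=0$ for all $x\in V$. Let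 $f_1,\dots,f_q\in K[V]$ be algebraically independent invariant polynomials of $\rho$, not necessarily homogeneous. Suppose that the stabiliser of a regular point is trivial, $\mathrm{St}_{\mathrm{reg}}=\{0\}$. Then $$\sum_{\alpha=1}^q \deg f_\alpha \;\ge\; \dim V-\deg \mathsf p_\rho .$$ Moreover, if in addition $\mathrm{codim}\,\mathsf{Sing}\ge 2$, then $$\sum_{\alpha=1}^q \deg f_\alpha \;\ge\; \dim V .$$ -/

import Mathlib

open MvPolynomial

attribute [local instance] LieRing.ofAssociativeRing

namespace LieRep

section Geometry

variable {K 𝔤 V : Type*} [Field K] [LieRing 𝔤] [LieAlgebra K 𝔤] [AddCommGroup V] [Module K V]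

/-- The operator `R_x : 𝔤 → V`, `R_x ξ = ρ(ξ) x`. -/
def orbitMap (ρ : 𝔤 →ₗ⁅K⁆ Module.End K V) (x : V) : 𝔤 →ₗ[K] V where
  toFun ξ := ρ ξ x
  map_add' ξ η := by simp
  map_smul' c ξ := by simp

/-- The stabiliser `St_x = Ker R_x`. -/
def stabiliser (ρ : 𝔤 →ₗ⁅K⁆ Module.End K V) (x : V) : Submodule K 𝔤 :=
  LinearMap.ker (orbitMap ρ x)

/-- A point is regular if its stabiliser has the smallest possible dimension. -/
def IsRegular (ρ : 𝔤 →ₗ⁅K⁆ Module.End K V) (a : V) : Prop :=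
  ∀ x : V, Module.finrank K (stabiliser ρ a) ≤ Module.finrank K (stabiliser ρ x)

/-- The set of singular (that is, non-regular) points. -/
def Sing (ρ : 𝔤 →ₗ⁅K⁆ Module.End K V) : Set V :=
  {x | ¬ IsRegular ρ x}

/-- The dimension of a regular orbit, `r = max_x rk R_x`. -/
noncomputable def dimRegOrbit (ρ : 𝔤 →ₗ⁅K⁆ Module.End K V) : ℕ :=
  ⨆ x : V, Module.finrank K (LinearMap.range (orbitMap ρ x))

/-- The codimension of a regular orbit, `q = dim V - r` (note that `r ≤ dim V`). -/
noncomputable def codimRegOrbit (ρ : 𝔤 →ₗ⁅K⁆ Module.End K V) : ℕ :=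
  Module.finrank K V - dimRegOrbit ρ

/-- The maximum in the definition of `r` is bounded by `dim V`, is attained, and is attained
exactly at the regular points. -/
theorem finrank_range_orbitMap_le [FiniteDimensional K V]
    (ρ : 𝔤 →ₗ⁅K⁆ Module.End K V) (x : V) :
    Module.finrank K (LinearMap.range (orbitMap ρ x)) ≤ dimRegOrbit ρ :=
  le_ciSup (f := fun y : V => Module.finrank K (LinearMap.range (orbitMap ρ y)))
    ⟨Module.finrank K V, by rintro _ ⟨y, rfl⟩; exact Submodule.finrank_le _⟩ x

theorem isRegular_iff [FiniteDimensional K 𝔤] [FiniteDimensional K V]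
    (ρ : 𝔤 →ₗ⁅K⁆ Module.End K V) (a : V) :
    IsRegular ρ a ↔ Module.finrank K (LinearMap.range (orbitMap ρ a)) = dimRegOrbit ρ := by
  have key : ∀ x, Module.finrank K (LinearMap.range (orbitMap ρ x)) +
      Module.finrank K (stabiliser ρ x) = Module.finrank K 𝔤 :=
    fun x => LinearMap.finrank_range_add_finrank_ker (orbitMap ρ x)
  constructor
  · intro h
    refine le_antisymm (finrank_range_orbitMap_le ρ a) (ciSup_le fun x => ?_)
    have h1 := h x
    have h2 := key x
    have h3 := key a
    omega
  · intro h x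
    have h1 := finrank_range_orbitMap_le ρ x
    have h2 := key x
    have h3 := key a
    omega

end Geometry

section Polynomials

/-! Polynomials on `V` are written in the linear coordinates given by a basis `b` of `V`:
the polynomial `f : MvPolynomial ι K` is the function `x ↦ f (coordinates of x)`. -/

variable {K 𝔤 V ι κ : Type*} [Field K] [LieRing 𝔤] [LieAlgebra K 𝔤] [AddCommGroup V] [Module K V]
  [Fintype ι]

/-- The differential `df(x) ∈ V*`. -/
noncomputable def differential (b : Module.Basis ι K V) (f : MvPolynomial ι K) (x : V) :
    Module.Dual K V :=
  ∑ i, eval (b.repr x) (pderiv i f) • b.coord i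

/-- `f` is an invariant of `ρ`: `R_x^* (df(x)) = 0` for all `x`. -/
def IsInvariant (b : Module.Basis ι K V) (ρ : 𝔤 →ₗ⁅K⁆ Module.End K V)
    (f : MvPolynomial ι K) : Prop :=
  ∀ x : V, (orbitMap ρ x).dualMap (differential b f x) = 0

/-- The matrix of `R_x` in the bases `c` of `𝔤` and `b` of `V`; its entries are linear forms
in the coordinates of `x`. -/
noncomputable def genericMatrix (b : Module.Basis ι K V) (c : Module.Basis κ K 𝔤)
    (ρ : 𝔤 →ₗ⁅K⁆ Module.End K V) : Matrix ι κ (MvPolynomial ι K) :=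
  Matrix.of fun i j => ∑ k, C (b.repr (ρ (c j) (b k)) i) * X k

/-- Evaluating `genericMatrix` at (the coordinates of) `x` gives the matrix of `R_x`. -/
theorem eval_genericMatrix (b : Module.Basis ι K V) (c : Module.Basis κ K 𝔤)
    (ρ : 𝔤 →ₗ⁅K⁆ Module.End K V) (x : V) (i : ι) (j : κ) :
    eval (b.repr x) (genericMatrix b c ρ i j) = b.repr (orbitMap ρ x (c j)) i := by
  have h : orbitMap ρ x (c j) = ∑ k, b.repr x k • ρ (c j) (b k) := by
    calc orbitMap ρ x (c j) = ρ (c j) (∑ k, b.repr x k • b k) := by rw [b.sum_repr]; rfl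
      _ = _ := by simp only [map_sum, map_smul]
  rw [h]
  simp [genericMatrix, mul_comm]

/-- The `r × r` minors, `r = dim O_reg`, of the matrix of `R_x`, as polynomials in `x`. -/
noncomputable def regMinor (b : Module.Basis ι K V) (c : Module.Basis κ K 𝔤)
    (ρ : 𝔤 →ₗ⁅K⁆ Module.End K V)
    (s : (Fin (dimRegOrbit ρ) ↪ ι) × (Fin (dimRegOrbit ρ) ↪ κ)) : MvPolynomial ι K :=
  ((genericMatrix b c ρ).submatrix s.1 s.2).det

/-- The fundamental semi-invariant `p_ρ`: the greatest common divisor of the `r × r` minors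
(the identically vanishing ones do not influence it). It is determined up to a nonzero scalar
factor; one choice is made here. -/
noncomputable def fundSemiInvariant [Finite κ] (b : Module.Basis ι K V) (c : Module.Basis κ K 𝔤)
    (ρ : 𝔤 →ₗ⁅K⁆ Module.End K V) : MvPolynomial ι K :=
  letI : NormalizedGCDMonoid (MvPolynomial ι K) := Classical.choice inferInstance
  letI : Fintype ((Fin (dimRegOrbit ρ) ↪ ι) × (Fin (dimRegOrbit ρ) ↪ κ)) := Fintype.ofFinite _
  Finset.univ.gcd (regMinor b c ρ)

theorem dvd_fundSemiInvariant_iff [Finite κ] (b : Module.Basis ι K V) (c : Module.Basis κ K 𝔤)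
    (ρ : 𝔤 →ₗ⁅K⁆ Module.End K V) (d : MvPolynomial ι K) :
    d ∣ fundSemiInvariant b c ρ ↔ ∀ s, d ∣ regMinor b c ρ s := by
  simp [fundSemiInvariant, Finset.dvd_gcd_iff]

/-- The codimension of `Sing` in `V`: the height of the ideal of all polynomials vanishing on
`Sing`, that is, the smallest codimension of an irreducible component (`⊤` if `Sing = ∅`). -/
noncomputable def codimSing (b : Module.Basis ι K V) (ρ : 𝔤 →ₗ⁅K⁆ Module.End K V) : ℕ∞ :=
  (vanishingIdeal K ((fun x : V => (b.repr x : ι → K)) '' Sing ρ)).height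

end Polynomials

end LieRep

/-! Let `J` be the Jacobian of the invariants and `G` the matrix of `R_x`. Invariance says `J * G =
0`, and since regular stabilisers are trivial, `G` generically has full column rank `r`. So the `q ×
q` minors of `J` are proportional to the complementary `r × r` minors of `G`. Algebraic independence
in characteristic zero gives `J` full rank, hence a nonzero factor. Dividing by the gcd `p` of the
minors of `G`, the proportionality becomes `N * p = h * m` with `h` a polynomial, `m` a nonzero
minor of `G` of degree `r`, and `N` up to sign the complementary minor of `J`, of degree at most `∑
(deg f_α - 1)`. Comparing degrees and adding `q` gives the first bound.

If `p` is not constant, all maximal minors vanish on the hypersurface of an irreducible factor,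
which therefore lies in `Sing`. Codimension at least two excludes this, so `deg p = 0`. -/

/-! ### Derivations and algebraic dependence -/

section Derivations

/-- A derivation over a domain of characteristic zero kills every algebraic element. -/
theorem Derivation.apply_eq_zero_of_isAlgebraic {R A : Type*} [CommRing R] [CharZero R]
    [IsDomain R] [CommRing A] [IsDomain A] [Algebra R A] [FaithfulSMul R A]
    (D : Derivation R A A) {a : A} (ha : IsAlgebraic R a) : D a = 0 := by
  obtain ⟨p, hp, hpa⟩ := ha
  induction h : p.natDegree using Nat.strong_induction_on generalizing p with
  | _ n ih =>
    -- Either `D a = 0`, or `p'` is an annihilator of `a` of smaller degree, nonzero by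
    -- characteristic zero.
    have hD : Polynomial.aeval a (Polynomial.derivative p) * D a = 0 := by
      rw [← smul_eq_mul, ← D.map_aeval, hpa, map_zero]
    rcases mul_eq_zero.mp hD with h0 | h0
    · have hdeg : p.natDegree ≠ 0 := by
        intro h1
        rw [Polynomial.eq_C_of_natDegree_eq_zero h1] at hp hpa
        rw [Polynomial.aeval_C] at hpa
        exact hp (by rw [(FaithfulSMul.algebraMap_eq_zero_iff R A).mp hpa, map_zero])
      refine ih _ (h ▸ Polynomial.natDegree_derivative_lt hdeg) _ ?_ h0 rfl
      exact fun h1 => hdeg (Polynomial.derivative_eq_zero.mp h1)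
    · exact h0

/-- A derivation vanishing on `S` is zero if the whole ring is algebraic over `K[S]`. -/
theorem Derivation.eq_zero_of_isAlgebraic_adjoin {K A : Type*} [Field K] [CharZero K]
    [CommRing A] [IsDomain A] [Algebra K A] (D : Derivation K A A) {S : Set A}
    [Algebra.IsAlgebraic (Algebra.adjoin K S) A] (hS : ∀ s ∈ S, D s = 0) : D = 0 := by
  have hadj : ∀ a ∈ Algebra.adjoin K S, D a = 0 := fun a ha =>
    Derivation.eqOn_adjoin (D1 := D) (D2 := 0) (fun s hs => by simpa using hS s hs) ha
  -- Vanishing on the subalgebra makes `D` linear over it, so the previous result applies with that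
  -- subalgebra as base ring.
  let D' : Derivation (Algebra.adjoin K S) A A := Derivation.mk'
    { toFun := D
      map_add' := map_add D
      map_smul' := fun c x => by
        simp [Algebra.smul_def, hadj _ c.2] }
    (fun x y => by simp)
  ext a
  have : CharZero (Algebra.adjoin K S) := charZero_of_injective_algebraMap
    (FaithfulSMul.algebraMap_injective K (Algebra.adjoin K S))
  exact D'.apply_eq_zero_of_isAlgebraic (Algebra.IsAlgebraic.isAlgebraic a)

end Derivations

namespace MvPolynomial

/-! ### Jacobian criterion for algebraic independence -/

section Jacobian

variable {K ι σ : Type*} [Field K] [Fintype ι]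

/-- The Jacobian matrix of a family of polynomials. -/
noncomputable def jacobian (f : σ → MvPolynomial ι K) : Matrix σ ι (MvPolynomial ι K) :=
  Matrix.of fun a i => pderiv i (f a)

/-- Lets a kernel vector of the Jacobian be read as a derivation that kills the whole family. -/
theorem jacobian_mulVec (f : σ → MvPolynomial ι K) (w : ι → MvPolynomial ι K) (a : σ) :
    (jacobian f).mulVec w a = mkDerivation K w (f a) := by
  classical
  have hsum : ∀ g, (∑ i, w i • pderiv i : Derivation K _ (MvPolynomial ι K)) g =
      ∑ i, w i * pderiv i g := fun g =>
    (congrFun (map_sum Derivation.coeFnAddMonoidHom (fun i => w i • pderiv i)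
      Finset.univ) g).trans (Finset.sum_apply g _ _)
  have h : mkDerivation K w = ∑ i, w i • pderiv i := by
    refine derivation_ext fun j => ?_
    simp [hsum, mkDerivation_X, pderiv_X, Pi.single_apply]
  rw [h]
  simp [jacobian, Matrix.mulVec, dotProduct, hsum, mul_comm]

/-- The Jacobian of an algebraically independent family in characteristic zero has full rank. -/
theorem exists_det_jacobian_mul_ne_zero [CharZero K] [Fintype σ] [DecidableEq σ]
    {f : σ → MvPolynomial ι K} (hf : AlgebraicIndependent K f) :
    ∃ B : Matrix ι σ (MvPolynomial ι K), (jacobian f * B).det ≠ 0 := by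
  classical
  obtain ⟨S, hfS, hS⟩ := exists_isTranscendenceBasis_superset hf.to_subtype_range
  -- The variables are also a transcendence basis, so the completed family has a square Jacobian.
  obtain ⟨e⟩ : Nonempty (ι ≃ S) := by
    have h := (IsTranscendenceBasis.mvPolynomial ι K).lift_cardinalMk_eq hS
    exact Cardinal.lift_mk_eq'.mp h
  let x : ι → MvPolynomial ι K := fun i => e i
  have hdet : (jacobian x).det ≠ 0 := by
    rw [Ne, ← Matrix.exists_mulVec_eq_zero_iff]
    rintro ⟨w, hw, hJ⟩
    have : Algebra.IsAlgebraic (Algebra.adjoin K S) (MvPolynomial ι K) := by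
      have := hS.isAlgebraic
      rwa [Subtype.range_coe] at this
    have hD : mkDerivation K w = 0 := by
      refine Derivation.eq_zero_of_isAlgebraic_adjoin (S := S) _ fun s hs => ?_
      have h := congrFun hJ (e.symm ⟨s, hs⟩)
      rw [jacobian_mulVec] at h
      simpa [x] using h
    refine hw ?_
    ext1 i
    rw [← mkDerivation_X K w i, hD]
    rfl
  let g : σ → ι := fun a => e.symm ⟨f a, hfS ⟨a, rfl⟩⟩
  have hg : Function.Injective g := fun a a' h => hf.injective (by simpa [g] using h)
  -- `g` locates each `f a` in the completed family; the matching adjugate columns make the product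
  -- a nonzero scalar matrix.
  refine ⟨(jacobian x).adjugate.submatrix id g, ?_⟩
  have hJ : jacobian f = (jacobian x).submatrix g id := by
    ext a i
    simp [jacobian, x, g]
  have h1 : jacobian f * (jacobian x).adjugate.submatrix id g
      = (jacobian x).det • (1 : Matrix σ σ (MvPolynomial ι K)) := by
    rw [hJ]
    ext1 a a'
    have := congrFun (congrFun (Matrix.mul_adjugate (jacobian x)) (g a)) (g a')
    simpa [Matrix.mul_apply, Matrix.one_apply, hg.eq_iff] using this
  rw [h1, Matrix.det_smul, Matrix.det_one, mul_one]
  exact pow_ne_zero _ hdet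

end Jacobian

/-! ### Degrees of derivatives and determinants -/

section Degree

variable {K ι n : Type*} [CommRing K]

theorem totalDegree_pderiv_le (i : ι) (f : MvPolynomial ι K) :
    (pderiv i f).totalDegree ≤ f.totalDegree - 1 := by
  rw [totalDegree_eq]
  refine Finset.sup_le fun m hm => ?_
  rw [mem_support_iff, coeff_pderiv] at hm
  have h := le_totalDegree (mem_support_iff.mpr (left_ne_zero_of_mul hm))
  rw [Finsupp.card_toMultiset]
  change (m + Finsupp.single i 1).degree ≤ _ at h
  rw [map_add, Finsupp.degree_single] at h
  change m.degree ≤ _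
  omega

theorem totalDegree_det_le [Fintype n] [DecidableEq n] (M : Matrix n n (MvPolynomial ι K))
    (d : n → ℕ) (h : ∀ i j, (M i j).totalDegree ≤ d i) : M.det.totalDegree ≤ ∑ i, d i := by
  -- Transposing makes each product in the expansion run over rows, where the bound `d` lives.
  rw [← Matrix.det_transpose, Matrix.det_apply]
  refine totalDegree_finsetSum_le fun τ _ => ?_
  rw [Units.smul_def]
  refine (totalDegree_smul_le _ _).trans ((totalDegree_finsetProd _ _).trans ?_)
  exact Finset.sum_le_sum fun i _ => h i (τ i)

theorem isHomogeneous_det [Fintype n] [DecidableEq n] {M : Matrix n n (MvPolynomial ι K)}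
    (h : ∀ i j, (M i j).IsHomogeneous 1) : M.det.IsHomogeneous (Fintype.card n) := by
  rw [Matrix.det_apply]
  refine IsHomogeneous.sum _ _ _ fun τ _ => ?_
  rw [Units.smul_def, ← mem_homogeneousSubmodule]
  refine zsmul_mem ?_ _
  rw [mem_homogeneousSubmodule]
  simpa using IsHomogeneous.prod Finset.univ (fun i => M (τ i) i) (fun _ => 1) fun i _ => h _ _

end Degree

end MvPolynomial

/-! ### Maximal minors -/

namespace Matrix

/-- A matrix over a field with linearly independent columns has a nonzero maximal minor. -/
theorem exists_det_submatrix_ne_zero {K ι κ : Type*} [Field K] [Fintype ι] [Fintype κ]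
    [DecidableEq κ] (M : Matrix ι κ K) (h : LinearIndependent K M.col) :
    ∃ g : κ ↪ ι, (M.submatrix g id).det ≠ 0 := by
  obtain ⟨τ, a, ha, hspan, hli⟩ := exists_linearIndependent' K M.row
  have : Fintype τ := Fintype.ofInjective a ha
  have hcard : Fintype.card κ = Fintype.card τ := by
    have h' : LinearIndependent K M.transpose.row := h
    rw [← h'.rank_matrix, M.rank_transpose, M.rank_eq_finrank_span_row, ← hspan, finrank_span_eq_card hli]
  let e := Fintype.equivOfCardEq hcard
  refine ⟨⟨fun k => a (e k), ha.comp e.injective⟩, ?_⟩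
  rw [← isUnit_iff_ne_zero, ← Matrix.isUnit_iff_isUnit_det,
    ← Matrix.linearIndependent_rows_iff_isUnit]
  exact hli.comp e e.injective

/-- Complementary maximal minors of matrices `J`, `G` with `J * G = 0` are proportional. -/
theorem det_fromRows_mul_det_fromCols {R ι σ τ : Type*} [CommRing R] [Fintype ι] [Fintype σ]
    [Fintype τ] [DecidableEq σ] [DecidableEq τ] (e : σ ⊕ τ ≃ ι)
    (J : Matrix σ ι R) (A : Matrix τ ι R) (B : Matrix ι σ R) (G : Matrix ι τ R)
    (h : J * G = 0) :
    ((fromRows J A).submatrix id e).det * ((fromCols B G).submatrix e id).det =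
      (J * B).det * (A * G).det := by
  -- The product of the two square matrices is block lower triangular because `J * G = 0`.
  rw [← det_mul, submatrix_mul_equiv, fromRows_mul_fromCols, h, submatrix_id_id,
    det_fromBlocks_zero₁₂]

end Matrix

/-! ### Orbit maps, invariants and the fundamental semi-invariant -/

namespace LieRep

variable {K 𝔤 V ι κ : Type*} [Field K] [LieRing 𝔤] [LieAlgebra K 𝔤] [AddCommGroup V]
  [Module K V] [Fintype ι]

theorem exists_isRegular (ρ : 𝔤 →ₗ⁅K⁆ Module.End K V) : ∃ a, IsRegular ρ a :=
  have : Nonempty V := ⟨0⟩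
  ⟨_, fun x => Function.argmin_le (fun x => Module.finrank K (stabiliser ρ x)) x⟩

theorem dimRegOrbit_eq [FiniteDimensional K 𝔤] [FiniteDimensional K V]
    {ρ : 𝔤 →ₗ⁅K⁆ Module.End K V} {a : V} (ha : IsRegular ρ a) (hst : stabiliser ρ a = ⊥) :
    dimRegOrbit ρ = Module.finrank K 𝔤 := by
  rw [← (isRegular_iff ρ a).mp ha]
  exact LinearMap.finrank_range_of_inj (LinearMap.ker_eq_bot.mp hst)

theorem dimRegOrbit_le [FiniteDimensional K V] (ρ : 𝔤 →ₗ⁅K⁆ Module.End K V) :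
    dimRegOrbit ρ ≤ Module.finrank K V :=
  ciSup_le fun _ => Submodule.finrank_le _

theorem isHomogeneous_regMinor (b : Module.Basis ι K V) (c : Module.Basis κ K 𝔤)
    (ρ : 𝔤 →ₗ⁅K⁆ Module.End K V) (s : (Fin (dimRegOrbit ρ) ↪ ι) × (Fin (dimRegOrbit ρ) ↪ κ)) :
    (regMinor b c ρ s).IsHomogeneous (dimRegOrbit ρ) := by
  have h := isHomogeneous_det (M := (genericMatrix b c ρ).submatrix s.1 s.2) fun i j =>
    IsHomogeneous.sum _ _ _ fun k _ => by
      simpa using (isHomogeneous_C ι _).mul (isHomogeneous_X K k)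
  rwa [Fintype.card_fin] at h

/-- Where the stabiliser is trivial, some maximal minor of the generic matrix is nonzero. -/
theorem exists_eval_regMinor_ne_zero [Fintype κ] (b : Module.Basis ι K V)
    (c : Module.Basis κ K 𝔤) (ρ : 𝔤 →ₗ⁅K⁆ Module.End K V) (σ : Fin (dimRegOrbit ρ) ≃ κ) {x : V}
    (hx : stabiliser ρ x = ⊥) :
    ∃ g : Fin (dimRegOrbit ρ) ↪ ι, eval (b.repr x) (regMinor b c ρ (g, σ.toEmbedding)) ≠ 0 := by
  let M : Matrix ι (Fin (dimRegOrbit ρ)) K :=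
    Matrix.of fun i j => b.repr (orbitMap ρ x (c (σ j))) i
  have hM : LinearIndependent K M.col := by
    have h := (c.linearIndependent.comp σ σ.injective).map' (orbitMap ρ x) hx
    exact h.map' b.equivFun.toLinearMap b.equivFun.ker
  obtain ⟨g, hg⟩ := M.exists_det_submatrix_ne_zero hM
  refine ⟨g, ?_⟩
  rw [regMinor, RingHom.map_det]
  convert hg using 2
  ext i j
  exact eval_genericMatrix b c ρ x _ _

/-- The differentials of invariants annihilate the image of `R_x`. -/
theorem jacobian_mul_genericMatrix [Infinite K] {τ : Type*} (b : Module.Basis ι K V)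
    (c : Module.Basis κ K 𝔤) {ρ : 𝔤 →ₗ⁅K⁆ Module.End K V} {f : τ → MvPolynomial ι K}
    (hinv : ∀ α, IsInvariant b ρ (f α)) : jacobian f * genericMatrix b c ρ = 0 := by
  ext1 α j
  refine MvPolynomial.funext fun y => ?_
  obtain ⟨x, rfl⟩ := b.equivFun.surjective y
  have h := LinearMap.congr_fun (hinv α x) (c j)
  simp only [b.equivFun_apply, Matrix.mul_apply, map_sum, map_mul, eval_genericMatrix]
  simpa [jacobian, differential] using h

/-- If `codim Sing ≥ 2` and regular points have trivial stabiliser, then the fundamental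
semi-invariant is constant. -/
theorem isUnit_fundSemiInvariant [IsAlgClosed K] [Fintype κ] (b : Module.Basis ι K V)
    (c : Module.Basis κ K 𝔤) (ρ : 𝔤 →ₗ⁅K⁆ Module.End K V) (σ : Fin (dimRegOrbit ρ) ≃ κ)
    (hst : ∀ a : V, IsRegular ρ a → stabiliser ρ a = ⊥) (hp : fundSemiInvariant b c ρ ≠ 0)
    (hcodim : 2 ≤ codimSing b ρ) : IsUnit (fundSemiInvariant b c ρ) := by
  by_contra hu
  obtain ⟨π, hπ, hdvd⟩ := WfDvdMonoid.exists_irreducible_factor hu hp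
  have hprime : (Ideal.span {π}).IsPrime :=
    (Ideal.span_singleton_prime hπ.ne_zero).mpr hπ.prime
  have hsub : zeroLocus K (Ideal.span {π}) ⊆ (fun x : V => (b.repr x : ι → K)) '' Sing ρ := by
    intro y hy
    have hb : (b.repr (b.equivFun.symm y) : ι → K) = y := b.equivFun.apply_symm_apply y
    refine ⟨b.equivFun.symm y, fun hreg => ?_, hb⟩
    obtain ⟨g, hg⟩ := exists_eval_regMinor_ne_zero b c ρ σ (hst _ hreg)
    obtain ⟨t, ht⟩ := hdvd.trans
      ((dvd_fundSemiInvariant_iff b c ρ _).mp dvd_rfl (g, σ.toEmbedding))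
    have hπy : eval y π = 0 := by
      simpa [aeval_eq_eval] using hy π (Ideal.mem_span_singleton_self π)
    rw [ht, hb, map_mul, hπy, zero_mul] at hg
    exact hg rfl
  -- By the Nullstellensatz the prime ideal `(π)` is the full vanishing ideal of its zero locus;
  -- Krull's theorem then bounds its height by one.
  have hle : vanishingIdeal K ((fun x : V => (b.repr x : ι → K)) '' Sing ρ) ≤ Ideal.span {π} :=
    (vanishingIdeal_anti_mono hsub).trans_eq (IsPrime.vanishingIdeal_zeroLocus _)
  have h1 : codimSing b ρ ≤ 1 :=
    (Ideal.height_mono hle).trans (Ideal.height_span_singleton_le_one hπ.not_isUnit)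
  exact absurd (hcodim.trans h1) (by decide)

/-- The degree estimate for algebraically independent invariants in terms of the fundamental
semi-invariant. -/
theorem dimRegOrbit_le_degree [CharZero K] [Fintype κ]
    (b : Module.Basis ι K V) (c : Module.Basis κ K 𝔤) (ρ : 𝔤 →ₗ⁅K⁆ Module.End K V)
    (σ : Fin (dimRegOrbit ρ) ≃ κ) {τ : Type*} [Fintype τ]
    (e : τ ⊕ Fin (dimRegOrbit ρ) ≃ ι) {f : τ → MvPolynomial ι K} (hf : AlgebraicIndependent K f)
    (hinv : ∀ α, IsInvariant b ρ (f α)) (g : Fin (dimRegOrbit ρ) ↪ ι)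
    (hg : regMinor b c ρ (g, σ.toEmbedding) ≠ 0) :
    dimRegOrbit ρ ≤ ∑ α, ((f α).totalDegree - 1) + (fundSemiInvariant b c ρ).totalDegree := by
  classical
  set p := fundSemiInvariant b c ρ with hpdef
  obtain ⟨B, hB⟩ := exists_det_jacobian_mul_ne_zero hf
  set d := (jacobian f * B).det
  let G := (genericMatrix b c ρ).submatrix id σ
  -- Rows of the identity: `A i * G` picks the rows `i` of `G`, and in `N i` these rows have degree
  -- zero.
  let A (i : Fin (dimRegOrbit ρ) ↪ ι) : Matrix (Fin (dimRegOrbit ρ)) ι (MvPolynomial ι K) :=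
    (1 : Matrix ι ι (MvPolynomial ι K)).submatrix i id
  let Δ := ((Matrix.fromCols B G).submatrix e id).det
  let N (i) := ((Matrix.fromRows (jacobian f) (A i)).submatrix id e).det
  have hJG : jacobian f * G = 0 := by
    have h := jacobian_mul_genericMatrix b c hinv
    ext1 α j
    exact congrFun (congrFun h α) (σ j)
  have key (i) : N i * Δ = d * regMinor b c ρ (i, σ.toEmbedding) := by
    have hA : A i * G = (genericMatrix b c ρ).submatrix i σ := by
      rw [← Matrix.submatrix_mul _ _ i id σ Function.bijective_id, Matrix.one_mul]
    have h := Matrix.det_fromRows_mul_det_fromCols e (jacobian f) (A i) B G hJG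
    rw [hA] at h
    exact h
  have hdvd : ∀ s, Δ ∣ d * regMinor b c ρ s := by
    rintro ⟨i, s⟩
    -- All `r` columns are used, so changing the column selection only changes the sign of the
    -- minor.
    have hs : Function.Bijective s := (Fintype.bijective_iff_injective_and_card s).mpr
      ⟨s.injective, Fintype.card_congr σ⟩
    let τ' : Equiv.Perm (Fin (dimRegOrbit ρ)) := (Equiv.ofBijective s hs).trans σ.symm
    have h : regMinor b c ρ (i, s) =
        ((Equiv.Perm.sign τ' : ℤ) : MvPolynomial ι K) * regMinor b c ρ (i, σ.toEmbedding) := by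
      rw [regMinor, regMinor, ← Matrix.det_permute']
      congr 1
      ext1 k l
      simp [τ']
    rw [h, mul_left_comm, ← key i]
    exact Dvd.intro_left _ (mul_assoc _ _ _)
  obtain ⟨h, hh⟩ : Δ ∣ d * p := by
    let : NormalizedGCDMonoid (MvPolynomial ι K) := Classical.choice inferInstance
    let : Fintype ((Fin (dimRegOrbit ρ) ↪ ι) × (Fin (dimRegOrbit ρ) ↪ κ)) := Fintype.ofFinite _
    exact (Finset.dvd_gcd fun s _ => hdvd s).trans
      (Finset.gcd_mul_left' Finset.univ (regMinor b c ρ) d).dvd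
  have hp : p ≠ 0 := fun h0 => hg (zero_dvd_iff.mp
    (h0 ▸ (dvd_fundSemiInvariant_iff b c ρ _).mp dvd_rfl (g, σ.toEmbedding)))
  have hΔ : Δ ≠ 0 := fun h0 => mul_ne_zero hB hg (by rw [← key, h0, mul_zero])
  have hN : N g ≠ 0 := fun h0 => mul_ne_zero hB hg (by rw [← key, h0, zero_mul])
  have hh0 : h ≠ 0 := fun h0 => mul_ne_zero hB hp (by rw [hh, h0, mul_zero])
  -- Substituting `d * p = Δ * h` into `key g` and cancelling `Δ * d` leaves an identity free of the
  -- auxiliary `B`.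
  have heq : N g * p = h * regMinor b c ρ (g, σ.toEmbedding) := by
    refine mul_left_cancel₀ (mul_ne_zero hΔ hB) ?_
    linear_combination (N g * Δ) * hh + (Δ * h) * key g
  have hdeg := congrArg totalDegree heq
  rw [totalDegree_mul_of_isDomain hN hp, totalDegree_mul_of_isDomain hh0 hg,
    (isHomogeneous_regMinor b c ρ _).totalDegree hg] at hdeg
  have hNdeg : (N g).totalDegree ≤ ∑ α, ((f α).totalDegree - 1) := by
    refine (totalDegree_det_le _ (Sum.elim (fun α => (f α).totalDegree - 1) fun _ => 0)
      ?_).trans_eq (by simp)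
    rintro (α | k) j
    · exact totalDegree_pderiv_le _ _
    · simp only [Matrix.submatrix_apply, id, Matrix.fromRows_apply_inr, Sum.elim_inr, A,
        Matrix.one_apply]
      split_ifs <;> simp
  omega

end LieRep

/-! ### The degree inequalities -/

theorem mainTheorem7
    {K : Type*} [Field K] [IsAlgClosed K] [CharZero K]
    {𝔤 : Type*} [LieRing 𝔤] [LieAlgebra K 𝔤] [FiniteDimensional K 𝔤]
    {V : Type*} [AddCommGroup V] [Module K V] [FiniteDimensional K V]
    (ρ : 𝔤 →ₗ⁅K⁆ Module.End K V)
    {ι κ : Type*} [Fintype ι] [Fintype κ]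
    (b : Module.Basis ι K V) (c : Module.Basis κ K 𝔤)
    (f : Fin (LieRep.codimRegOrbit ρ) → MvPolynomial ι K)
    (hf : AlgebraicIndependent K f)
    (hinv : ∀ α, LieRep.IsInvariant b ρ (f α))
    (hst : ∀ a : V, LieRep.IsRegular ρ a → LieRep.stabiliser ρ a = ⊥) :
    (Module.finrank K V : ℤ) - ((LieRep.fundSemiInvariant b c ρ).totalDegree : ℤ)
        ≤ ∑ α, ((f α).totalDegree : ℤ) ∧
    (2 ≤ LieRep.codimSing b ρ →
      (Module.finrank K V : ℤ) ≤ ∑ α, ((f α).totalDegree : ℤ)) := by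
  obtain ⟨a, ha⟩ := LieRep.exists_isRegular ρ
  have hr := LieRep.dimRegOrbit_eq ha (hst a ha)
  have hle := LieRep.dimRegOrbit_le ρ
  have hq : LieRep.codimRegOrbit ρ + LieRep.dimRegOrbit ρ = Module.finrank K V :=
    Nat.sub_add_cancel hle
  obtain ⟨σ⟩ : Nonempty (Fin (LieRep.dimRegOrbit ρ) ≃ κ) :=
    ⟨Fintype.equivOfCardEq (by rw [Fintype.card_fin, hr, Module.finrank_eq_card_basis c])⟩
  obtain ⟨e⟩ : Nonempty (Fin (LieRep.codimRegOrbit ρ) ⊕ Fin (LieRep.dimRegOrbit ρ) ≃ ι) :=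
    ⟨Fintype.equivOfCardEq (by simp [hq, Module.finrank_eq_card_basis b])⟩
  obtain ⟨g, hg⟩ := LieRep.exists_eval_regMinor_ne_zero b c ρ σ (hst a ha)
  have hg0 : LieRep.regMinor b c ρ (g, σ.toEmbedding) ≠ 0 := fun h => hg (by rw [h, map_zero])
  have hmain := LieRep.dimRegOrbit_le_degree b c ρ σ e hf hinv g hg0
  -- A constant would be algebraic over `K`; hence the truncated subtraction `deg f_α - 1` is a true
  -- one.
  have hpos : ∀ α, 1 ≤ (f α).totalDegree := fun α => by
    by_contra h
    have h0 := totalDegree_eq_zero_iff_eq_C.mp (by omega : (f α).totalDegree = 0)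
    exact hf.transcendental α (h0 ▸ isAlgebraic_algebraMap _)
  have hsum : ∑ α, ((f α).totalDegree - 1) + LieRep.codimRegOrbit ρ =
      ∑ α, (f α).totalDegree := by
    calc _ = ∑ α, ((f α).totalDegree - 1 + 1) := by simp [Finset.sum_add_distrib]
      _ = _ := Finset.sum_congr rfl fun α _ => Nat.sub_add_cancel (hpos α)
  have hfirst : Module.finrank K V ≤
      ∑ α, (f α).totalDegree + (LieRep.fundSemiInvariant b c ρ).totalDegree := by omega
  refine ⟨by rw [sub_le_iff_le_add]; exact_mod_cast hfirst, fun hcodim => ?_⟩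
  have hp : LieRep.fundSemiInvariant b c ρ ≠ 0 := fun h0 => hg0 (zero_dvd_iff.mp
    (h0 ▸ (LieRep.dvd_fundSemiInvariant_iff b c ρ _).mp dvd_rfl (g, σ.toEmbedding)))
  have hunit := LieRep.isUnit_fundSemiInvariant b c ρ σ hst hp hcodim
  rw [(isUnit_iff_totalDegree_of_isReduced.mp hunit).2, add_zero] at hfirst
  exact_mod_cast hfirst
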